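/- Let $a,b,c,d$ be indeterminates, or more generally elements of a field $K$, such that $Q:=abcd$ satisfies $Q^k\ne 1$ for all $k\ge 1$. For a partition $\pi=(\lambda_1\ge\lambda_2\ge\cdots)$ fill the boxes of each odd-indexed row of its Ferrers diagram alternately with $a,b,a,b,\dots$ and those of each even-indexed row alternately with $c,d,c,d,\dots$, and let the Boulet–Stanley weight $\omega_\pi(a,b,c,d)=a^{\#a}b^{\#b}c^{\#c}d^{\#d}$ be the product of all entries. Let $$\Phi_{L,P}(a,b,c,d)=\sum_{\pi}\omega_\pi(a,b,c,d),$$ where the sum runs over all partitions $\pi$ (including the empty one) with all parts $\le L$ and at most $P$ parts. Write $(x;q)_n=\prod_{i=0}^{n-1}(1-xq^i)$ and, for integers $k, n$, $\left[{k\atop n}\right]_q=\frac{(q;q)_k}{(q;q)_n(q;q)_{k-n}}$ if $k\ge n\ge 0$ and $\left[{k\atop n}\right]_q=0$ otherwise. Let $\nu\in\{0,1\}$, let $N\ge 0$ be an integer, and let $2N+\nu$ and $M$ be positive integers. Then $$\begin{aligned}\Phi_{2N+\nu,2M}(a,b,c,d)=\sum_{l=0}^{N}&\left[{N-l+M-1\atop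 N-l}\right]_Q(ab)^{N-l}\sum_{m_2=0}^{l}(abc)^{m_2}Q^{\binom{m_2}{2}}\left[{l\atop m_2}\right]_Q\\ &\times\sum_{m_1=0}^{l+\nu}a^{m_1}Q^{\binom{m_1}{2}}\left[{l+\nu\atop m_1}\right]_Q\sum_{n=0}^{M-m_1-m_2}\left[{M+l-n-m_1-m_2\atop M-n-m_1-m_2}\right]_Q\frac{(Q^{l+\nu};Q)_n}{(Q;Q)_n}(ac)^n,\end{aligned}$$ where the sum over $n$ is empty if $m_1+m_2>M$. Moreover, for every $q\in K$ with $q^k\ne1$ for all $k\ge1$ (in particular for an indeterminate $q$) and all integers $L,M\ge0$, $$\Phi_{L,2M}(q,q,q,q)=\left[{L+2M\atop 2M}\right]_q .$$ -/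

import Mathlib

noncomputable section

/-- The entry of the box in row `x.1` and column `x.2` (both counted from `0`) of the four-variable
decorated Ferrers diagram: the 1st, 3rd, 5th, ... rows are filled with `a, b, a, b, ...`, and the
2nd, 4th, 6th, ... rows with `c, d, c, d, ...`. -/
def boxEntry {R : Type*} (a b c d : R) (x : ℕ × ℕ) : R :=
  if Even x.1 then (if Even x.2 then a else b) else (if Even x.2 then c else d)

/-- The Boulet-Stanley weight of a partition, given by its diagram: the product of the entries of
all boxes of the decorated diagram, that is `a ^ #a * b ^ #b * c ^ #c * d ^ #d`. -/
def bouletWeight {R : Type*} [CommSemiring R] (a b c d : R) (μ : YoungDiagram) : R :=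
  ∏ x ∈ μ.cells, boxEntry a b c d x

/-- The partitions all of whose parts are at most `L` and which have at most `P` parts.
The parts of a partition are the row lengths of its diagram. -/
def boundedPartitions (L P : ℕ) : Set YoungDiagram :=
  {μ | (∀ x ∈ μ.rowLens, x ≤ L) ∧ μ.rowLens.length ≤ P}

theorem boundedPartitions_finite (L P : ℕ) : (boundedPartitions L P).Finite := by
  refine Set.Finite.of_finite_image
    (f := fun μ : YoungDiagram => μ.cells)
    ((Finset.finite_toSet (Finset.range P ×ˢ Finset.range L).powerset).subset ?_)
    (fun μ _ ν _ h => YoungDiagram.ext h)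
  rintro _ ⟨μ, ⟨hL, hP⟩, rfl⟩
  simp only [Finset.mem_coe, Finset.mem_powerset]
  rintro ⟨i, j⟩ hij
  have hij' : (i, j) ∈ μ := hij
  have hj : j < μ.rowLen i := YoungDiagram.mem_iff_lt_rowLen.mp hij'
  have hi0 : (i, 0) ∈ μ := μ.up_left_mem le_rfl (Nat.zero_le j) hij'
  have hi : i < μ.rowLens.length := by
    rw [YoungDiagram.length_rowLens]
    exact YoungDiagram.mem_iff_lt_colLen.mp hi0
  have hmem : μ.rowLen i ∈ μ.rowLens := by
    rw [← YoungDiagram.get_rowLens (h := hi)]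
    exact List.getElem_mem hi
  have hle := hL _ hmem
  simp only [Finset.mem_product, Finset.mem_range]
  exact ⟨by omega, by omega⟩

/-- The generating function `Φ_{L,P}(a,b,c,d)` of partitions with parts at most `L` and at most `P`
parts, counted with Boulet-Stanley weights. -/
def boundedPhi {R : Type*} [CommSemiring R] (L P : ℕ) (a b c d : R) : R :=
  ∑ μ ∈ (boundedPartitions_finite L P).toFinset, bouletWeight a b c d μ

/-- The `q`-Pochhammer symbol `(x; q)_n = ∏_{i=0}^{n-1} (1 - x q^i)`. -/
def qPoch {R : Type*} [CommRing R] (x q : R) (n : ℕ) : R :=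
  ∏ i ∈ Finset.range n, (1 - x * q ^ i)

/-- The Gaussian binomial coefficient with top entry `k` and bottom entry `n`, in base `q`. -/
def gaussBinom {K : Type*} [Field K] (q : K) (k n : ℕ) : K :=
  if n ≤ k then qPoch q q k / (qPoch q q n * qPoch q q (k - n)) else 0

end

/-!
Write `Φ_{L,P}` for `boundedPhi L P a b c d`, with `Q = a * b * c * d`, and let a prime denote the
exchange `a ↔ b`, `c ↔ d`.

A partition with parts at most `L + 1` and at most `P + 1` parts either has at most `P` parts or
has a first column of height exactly `P + 1`. Deleting such a column shifts the decorated diagram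
by one column, so that
`Φ_{L+1,P+1} = Φ_{L+1,P} + w_{P+1} * Φ'_{L,P+1}` (`boundedPhi_succ_succ`), where `w` is the weight
of the column. If all weights equal `q`, this is the `q`-Pascal rule, which gives the second claim
(`boundedPhi_self`).

In general, put `A_M = ∑ L, Φ_{L,2M} x ^ L`. Eliminating the odd row bounds from the recursion gives
a first-order recursion in `M` (`phiSeries_two_mul_succ`):
`(1 - Q ^ (M+1) x²) (1 - ab Q ^ M x²) A_{M+1} = (1 + abc Q ^ M x²) A_M + (ac) ^ M a (1 + c) x A'_M`.

On the other side, by the `q`-binomial theorems the sum over `m₂`, `m₁`, `n` is the coefficient of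
`z ^ M` in `G_{i,j}(z) = (-abc z; Q)_i (-a z; Q)_j / ((z; Q)_{i+1} (ac z; Q)_j)` with `i = l` and
`j = l + ν` (`coeff_rowSeries`). Comparing factors, and using
`1 + a z = (1 - ac z) + a (1 + c) z`,
one finds (`one_sub_X_mul_rowSeries_succ_succ`)
`(1 - z) G_{i+1,j+1}(z) = (1 + abc z) G_{i,j}(Q z) + a (1 + c) z G'_{j,i+1}(ac z)`.
Hence `C_M = ∑ L, x ^ L [z ^ M] G_{⌊L/2⌋,⌈L/2⌉}(z)` satisfies the recursion of `A_M` without the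
factor `1 - ab Q ^ M x²`, and so `C_M = (ab x²; Q)_M A_M` (`rowCoeffSeries_eq`). Dividing by
`(ab x²; Q)_M`, which the `q`-binomial theorem expands, and comparing coefficients of
`x ^ (2N + ν)` yields the first claim.
-/

open PowerSeries

/-! ### A column recursion for bounded partitions -/

theorem mem_boundedPartitions_iff {L P : ℕ} {μ : YoungDiagram} :
    μ ∈ boundedPartitions L P ↔ ∀ x ∈ μ.cells, x.1 < P ∧ x.2 < L := by
  constructor
  · rintro ⟨hL, hP⟩ ⟨i, j⟩ hij
    rw [YoungDiagram.mem_cells] at hij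
    have hi : i < μ.rowLens.length := by
      rw [YoungDiagram.length_rowLens]
      exact YoungDiagram.mem_iff_lt_colLen.mp (μ.up_left_mem le_rfl (Nat.zero_le j) hij)
    have hmem : μ.rowLen i ∈ μ.rowLens := by
      rw [← YoungDiagram.get_rowLens (h := hi)]
      exact List.getElem_mem hi
    exact ⟨hi.trans_le hP, (YoungDiagram.mem_iff_lt_rowLen.mp hij).trans_le (hL _ hmem)⟩
  · intro h
    constructor
    · intro x hx
      obtain ⟨i, -, rfl⟩ := List.mem_map.mp hx
      by_contra! hlt
      exact lt_irrefl _ (h (i, L) (YoungDiagram.mem_iff_lt_rowLen.mpr hlt)).2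
    · rw [YoungDiagram.length_rowLens]
      by_contra! hlt
      exact lt_irrefl _ (h (P, 0) (YoungDiagram.mem_iff_lt_colLen.mpr hlt)).1

/-- The diagram obtained from `μ` by inserting a new first column of height `P`. When `μ` has more
than `P` rows the cells below row `P` are cut off, so that the result is always a diagram. -/
def prependColumn (P : ℕ) (μ : YoungDiagram) : YoungDiagram where
  cells := (Finset.range P).image (fun i => (i, 0)) ∪
    (μ.cells.filter fun x => x.1 < P).image fun x => (x.1, x.2 + 1)
  isLowerSet := by
    rintro ⟨i, j⟩ ⟨i', j'⟩ hle hmem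
    obtain ⟨hi, hj⟩ := Prod.mk_le_mk.mp hle
    simp only [Finset.coe_union, Finset.coe_image, Set.mem_union,
      Set.mem_image, Finset.mem_coe, Finset.mem_range, Prod.mk.injEq, Finset.mem_filter,
      YoungDiagram.mem_cells, Prod.exists] at hmem ⊢
    rcases j' with _ | j'
    · left
      refine ⟨i', ?_, rfl, rfl⟩
      rcases hmem with ⟨k, hk, rfl, -⟩ | ⟨k, l, ⟨-, hk⟩, rfl, -⟩ <;> omega
    · right
      rcases hmem with ⟨k, hk, rfl, h0⟩ | ⟨k, l, ⟨hkl, hk⟩, rfl, hl⟩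
      · omega
      · exact ⟨i', j', ⟨μ.up_left_mem hi (by omega) hkl, by omega⟩, rfl, rfl⟩

/-- The diagram obtained from `μ` by deleting its first column. -/
def dropColumn (μ : YoungDiagram) : YoungDiagram where
  cells := (μ.cells.filter fun x => 0 < x.2).image fun x => (x.1, x.2 - 1)
  isLowerSet := by
    rintro ⟨i, j⟩ ⟨i', j'⟩ hle hmem
    obtain ⟨hi, hj⟩ := Prod.mk_le_mk.mp hle
    simp only [Finset.coe_image, Set.mem_image, Finset.mem_coe, Finset.mem_filter,
      YoungDiagram.mem_cells, Prod.exists, Prod.mk.injEq] at hmem ⊢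
    obtain ⟨k, l, ⟨hkl, hl⟩, rfl, rfl⟩ := hmem
    exact ⟨i', j' + 1, ⟨μ.up_left_mem hi (by omega) hkl, by omega⟩, rfl, rfl⟩

theorem mem_prependColumn_zero {P i : ℕ} {μ : YoungDiagram} :
    (i, 0) ∈ prependColumn P μ ↔ i < P := by
  rw [← YoungDiagram.mem_cells]
  simp [prependColumn]

theorem mem_prependColumn_succ {P i j : ℕ} {μ : YoungDiagram} :
    (i, j + 1) ∈ prependColumn P μ ↔ (i, j) ∈ μ ∧ i < P := by
  rw [← YoungDiagram.mem_cells]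
  simp [prependColumn]

theorem mem_dropColumn {i j : ℕ} {μ : YoungDiagram} :
    (i, j) ∈ dropColumn μ ↔ (i, j + 1) ∈ μ := by
  rw [← YoungDiagram.mem_cells]
  simp only [dropColumn, Finset.mem_image, Finset.mem_filter, YoungDiagram.mem_cells, Prod.exists,
    Prod.mk.injEq]
  constructor
  · rintro ⟨k, l, ⟨hkl, hl⟩, rfl, rfl⟩
    rwa [Nat.sub_add_cancel hl]
  · exact fun h => ⟨i, j + 1, ⟨h, by omega⟩, rfl, rfl⟩

/-- The weight of a column of height `P` in a decorated diagram whose column entries alternate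
between `a` and `c`. -/
def columnWeight {R : Type*} [CommSemiring R] (a c : R) (P : ℕ) : R :=
  ∏ i ∈ Finset.range P, if Even i then a else c

theorem bouletWeight_prependColumn {R : Type*} [CommSemiring R] (a b c d : R) {P : ℕ}
    {μ : YoungDiagram} (hμ : ∀ x ∈ μ.cells, x.1 < P) :
    bouletWeight a b c d (prependColumn P μ) =
      columnWeight a c P * bouletWeight b a d c μ := by
  have hcells : (prependColumn P μ).cells = (Finset.range P).image (fun i => (i, 0)) ∪
      μ.cells.image fun x => (x.1, x.2 + 1) := by
    simp only [prependColumn, Finset.filter_true_of_mem hμ]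
  rw [bouletWeight, hcells, Finset.prod_union,
    Finset.prod_image (fun _ _ _ _ h => (Prod.mk.inj h).1),
    Finset.prod_image fun _ _ _ _ h =>
      Prod.ext (Prod.mk.inj h).1 (Nat.succ_injective (Prod.mk.inj h).2)]
  · refine congrArg₂ (· * ·) ?_ ?_
    · exact Finset.prod_congr rfl fun i _ => by simp [boxEntry]
    · refine Finset.prod_congr rfl fun x _ => ?_
      simp only [boxEntry, Nat.even_add_one]
      split_ifs <;> simp_all
  · rw [Finset.disjoint_left]
    simp

theorem boundedPhi_eq_one {R : Type*} [CommSemiring R] (a b c d : R) {L P : ℕ}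
    (h : L = 0 ∨ P = 0) : boundedPhi L P a b c d = 1 := by
  have key : (boundedPartitions_finite L P).toFinset = {⊥} := by
    ext μ
    rw [Set.Finite.mem_toFinset, mem_boundedPartitions_iff, Finset.mem_singleton]
    constructor
    · intro hμ
      ext x
      simp only [YoungDiagram.cells_bot, Finset.notMem_empty, iff_false]
      intro hx
      have := hμ x hx
      omega
    · rintro rfl
      simp
  rw [boundedPhi, key, Finset.sum_singleton, bouletWeight]
  simp

/-- A partition with at most `P + 1` parts either has at most `P` parts, or its first column has
height exactly `P + 1`; deleting that column exchanges the roles of `a, b` and of `c, d`. -/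
theorem boundedPhi_succ_succ {R : Type*} [CommSemiring R] (a b c d : R) (L P : ℕ) :
    boundedPhi (L + 1) (P + 1) a b c d =
      boundedPhi (L + 1) P a b c d + columnWeight a c (P + 1) * boundedPhi L (P + 1) b a d c := by
  classical
  simp only [boundedPhi]
  rw [← Finset.sum_filter_add_sum_filter_not _ (fun μ : YoungDiagram => (P, 0) ∉ μ)]
  congr 1
  · refine Finset.sum_congr ?_ fun _ _ => rfl
    ext μ
    simp only [Finset.mem_filter, Set.Finite.mem_toFinset, mem_boundedPartitions_iff]
    constructor
    · rintro ⟨h, h0⟩ ⟨i, j⟩ hx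
      have := h _ hx
      refine ⟨lt_of_not_ge fun hi => h0 ?_, this.2⟩
      exact μ.up_left_mem hi (Nat.zero_le _) hx
    · refine fun h => ⟨fun x hx => ⟨(h x hx).1.trans (Nat.lt_succ_self _), (h x hx).2⟩, fun h0 => ?_⟩
      exact lt_irrefl _ (h _ h0).1
  · rw [Finset.mul_sum]
    refine Finset.sum_bij' (fun μ _ => dropColumn μ) (fun μ _ => prependColumn (P + 1) μ)
      ?_ ?_ ?_ ?_ ?_
    · intro μ hμ
      simp only [Finset.mem_filter, Set.Finite.mem_toFinset, mem_boundedPartitions_iff] at hμ ⊢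
      rintro ⟨i, j⟩ hx
      have := hμ.1 _ (mem_dropColumn.mp hx)
      exact ⟨this.1, Nat.lt_of_succ_lt_succ this.2⟩
    · intro μ hμ
      simp only [Finset.mem_filter, Set.Finite.mem_toFinset, mem_boundedPartitions_iff,
        not_not] at hμ ⊢
      refine ⟨?_, mem_prependColumn_zero.mpr (Nat.lt_succ_self P)⟩
      rintro ⟨i, _ | j⟩ hx
      · exact ⟨mem_prependColumn_zero.mp hx, Nat.succ_pos _⟩
      · have := hμ _ (mem_prependColumn_succ.mp hx).1
        exact ⟨this.1, Nat.succ_lt_succ this.2⟩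
    · intro μ hμ
      simp only [Finset.mem_filter, Set.Finite.mem_toFinset, mem_boundedPartitions_iff,
        not_not] at hμ
      ext ⟨i, _ | j⟩
      · rw [YoungDiagram.mem_cells, YoungDiagram.mem_cells, mem_prependColumn_zero]
        exact ⟨fun hi => μ.up_left_mem (Nat.lt_succ_iff.mp hi) le_rfl hμ.2, fun h => (hμ.1 _ h).1⟩
      · rw [YoungDiagram.mem_cells, YoungDiagram.mem_cells, mem_prependColumn_succ, mem_dropColumn]
        exact ⟨fun h => h.1, fun h => ⟨h, (hμ.1 _ h).1⟩⟩
    · intro μ hμ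
      simp only [Set.Finite.mem_toFinset, mem_boundedPartitions_iff] at hμ
      ext ⟨i, j⟩
      rw [YoungDiagram.mem_cells, YoungDiagram.mem_cells, mem_dropColumn, mem_prependColumn_succ]
      exact ⟨fun h => h.1, fun h => ⟨h, (hμ _ h).1⟩⟩
    · intro μ hμ
      simp only [Finset.mem_filter, Set.Finite.mem_toFinset, mem_boundedPartitions_iff,
        not_not] at hμ
      have hdrop : ∀ x ∈ (dropColumn μ).cells, x.1 < P + 1 :=
        fun ⟨i, j⟩ hx => (hμ.1 _ (mem_dropColumn.mp hx)).1
      rw [← bouletWeight_prependColumn a b c d hdrop]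
      congr 1
      ext ⟨i, _ | j⟩
      · rw [YoungDiagram.mem_cells, YoungDiagram.mem_cells, mem_prependColumn_zero]
        exact ⟨fun h => (hμ.1 _ h).1, fun hi => μ.up_left_mem (Nat.lt_succ_iff.mp hi) le_rfl hμ.2⟩
      · rw [YoungDiagram.mem_cells, YoungDiagram.mem_cells, mem_prependColumn_succ, mem_dropColumn]
        exact ⟨fun h => ⟨h, (hμ.1 _ h).1⟩, fun h => h.1⟩

theorem columnWeight_two_mul {R : Type*} [CommSemiring R] (a c : R) (M : ℕ) :
    columnWeight a c (2 * M) = (a * c) ^ M := by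
  induction M with
  | zero => simp [columnWeight]
  | succ M ih =>
    rw [columnWeight] at ih
    rw [columnWeight, show 2 * (M + 1) = 2 * M + 1 + 1 by ring, Finset.prod_range_succ,
      Finset.prod_range_succ, ih, if_pos (even_two_mul M),
      if_neg (Nat.not_even_iff_odd.mpr (odd_two_mul_add_one M))]
    ring

theorem columnWeight_two_mul_add_one {R : Type*} [CommSemiring R] (a c : R) (M : ℕ) :
    columnWeight a c (2 * M + 1) = (a * c) ^ M * a := by
  rw [columnWeight, Finset.prod_range_succ, ← columnWeight, columnWeight_two_mul,
    if_pos (even_two_mul M)]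

/-! ### Gaussian binomial coefficients and `q`-binomial series -/

theorem qPoch_zero {R : Type*} [CommRing R] (x q : R) : qPoch x q 0 = 1 := by
  simp [qPoch]

theorem qPoch_succ {R : Type*} [CommRing R] (x q : R) (n : ℕ) :
    qPoch x q (n + 1) = qPoch x q n * (1 - x * q ^ n) := by
  simp [qPoch, Finset.prod_range_succ]

theorem qPoch_succ' {R : Type*} [CommRing R] (x q : R) (n : ℕ) :
    qPoch x q (n + 1) = (1 - x) * qPoch (x * q) q n := by
  rw [qPoch, Finset.prod_range_succ', qPoch, mul_comm]
  simp only [pow_zero, mul_one, pow_succ', mul_assoc]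

theorem qPoch_add {R : Type*} [CommRing R] (x q : R) (m n : ℕ) :
    qPoch x q (m + n) = qPoch x q m * qPoch (x * q ^ m) q n := by
  simp only [qPoch, Finset.prod_range_add, pow_add, mul_assoc]

theorem map_qPoch {R S : Type*} [CommRing R] [CommRing S] (f : R →+* S) (x q : R) (n : ℕ) :
    f (qPoch x q n) = qPoch (f x) (f q) n := by
  simp [qPoch]

section Field

variable {K : Type*} [Field K] {Q : K}

theorem qPoch_self_ne_zero (hQ : ∀ k : ℕ, 0 < k → Q ^ k ≠ 1) (n : ℕ) : qPoch Q Q n ≠ 0 := by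
  rw [qPoch, Finset.prod_ne_zero_iff]
  intro i _
  rw [← pow_succ']
  exact sub_ne_zero.mpr (hQ _ i.succ_pos).symm

theorem gaussBinom_zero_right (hQ : ∀ k : ℕ, 0 < k → Q ^ k ≠ 1) (n : ℕ) :
    gaussBinom Q n 0 = 1 := by
  simp [gaussBinom, qPoch_zero, qPoch_self_ne_zero hQ]

theorem gaussBinom_self (hQ : ∀ k : ℕ, 0 < k → Q ^ k ≠ 1) (n : ℕ) :
    gaussBinom Q n n = 1 := by
  simp [gaussBinom, qPoch_zero, qPoch_self_ne_zero hQ]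

theorem gaussBinom_eq_zero_of_lt {n m : ℕ} (h : n < m) : gaussBinom Q n m = 0 :=
  if_neg h.not_ge

theorem gaussBinom_add_left (m k : ℕ) :
    gaussBinom Q (m + k) m = qPoch Q Q (m + k) / (qPoch Q Q m * qPoch Q Q k) := by
  rw [gaussBinom, if_pos (Nat.le_add_right m k), Nat.add_sub_cancel_left]

theorem gaussBinom_pascal_left (hQ : ∀ k : ℕ, 0 < k → Q ^ k ≠ 1) (m k : ℕ) :
    gaussBinom Q (m + k + 1) (m + 1) =
      gaussBinom Q (m + k) m + Q ^ (m + 1) * gaussBinom Q (m + k) (m + 1) := by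
  have h := qPoch_self_ne_zero hQ
  rcases k with _ | k
  · simp [gaussBinom_self hQ, gaussBinom_eq_zero_of_lt (Nat.lt_succ_self m)]
  · rw [show m + (k + 1) + 1 = (m + 1) + (k + 1) by ring, gaussBinom_add_left, gaussBinom_add_left,
      show m + (k + 1) = (m + 1) + k by ring, gaussBinom_add_left,
      show m + 1 + (k + 1) = m + 1 + k + 1 by ring, qPoch_succ Q Q (m + 1 + k)]
    have hm := h (m + 1)
    have hk := h (k + 1)
    rw [qPoch_succ] at hm hk ⊢
    rw [qPoch_succ Q Q k]
    have := h m
    have := h k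
    have := right_ne_zero_of_mul hm
    have := right_ne_zero_of_mul hk
    field_simp
    ring

theorem gaussBinom_pascal_right (hQ : ∀ k : ℕ, 0 < k → Q ^ k ≠ 1) (m k : ℕ) :
    gaussBinom Q (m + k + 1) (m + 1) =
      Q ^ k * gaussBinom Q (m + k) m + gaussBinom Q (m + k) (m + 1) := by
  have h := qPoch_self_ne_zero hQ
  rcases k with _ | k
  · simp [gaussBinom_self hQ, gaussBinom_eq_zero_of_lt (Nat.lt_succ_self m)]
  · rw [show m + (k + 1) + 1 = (m + 1) + (k + 1) by ring, gaussBinom_add_left, gaussBinom_add_left,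
      show m + (k + 1) = (m + 1) + k by ring, gaussBinom_add_left,
      show m + 1 + (k + 1) = m + 1 + k + 1 by ring, qPoch_succ Q Q (m + 1 + k)]
    have hm := h (m + 1)
    have hk := h (k + 1)
    rw [qPoch_succ] at hm hk ⊢
    rw [qPoch_succ Q Q k]
    have := h m
    have := h k
    have := right_ne_zero_of_mul hm
    have := right_ne_zero_of_mul hk
    field_simp
    ring

/-- The finite `q`-binomial theorem, read off coefficient by coefficient. -/
theorem coeff_qPoch_neg (hQ : ∀ k : ℕ, 0 < k → Q ^ k ≠ 1) (t : K) (n m : ℕ) :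
    coeff m (qPoch (-(C t * X)) (C Q) n : K⟦X⟧) =
      t ^ m * Q ^ m.choose 2 * gaussBinom Q n m := by
  induction n generalizing m with
  | zero =>
    rcases m with _ | m
    · simp [qPoch_zero, gaussBinom_zero_right hQ]
    · simp [qPoch_zero, gaussBinom_eq_zero_of_lt, coeff_one]
  | succ n ih =>
    have key : (qPoch (-(C t * X)) (C Q) (n + 1) : K⟦X⟧) = qPoch (-(C t * X)) (C Q) n +
        C (t * Q ^ n) * (X * qPoch (-(C t * X)) (C Q) n) := by
      rw [qPoch_succ, map_mul, map_pow]
      ring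
    rw [key, map_add, coeff_C_mul]
    rcases m with _ | m
    · simp [ih, gaussBinom_zero_right hQ]
    · rw [coeff_succ_X_mul, ih, ih]
      rcases lt_or_ge n m with hlt | hle
      · rw [gaussBinom_eq_zero_of_lt hlt, gaussBinom_eq_zero_of_lt (hlt.trans (Nat.lt_succ_self _)),
          gaussBinom_eq_zero_of_lt (Nat.succ_lt_succ hlt)]
        ring
      · obtain ⟨k, rfl⟩ := Nat.exists_eq_add_of_le hle
        rw [gaussBinom_pascal_right hQ, Nat.choose_succ_succ' m 1, Nat.choose_one_right]
        ring

/-- The power series `1 / (t X; Q)_s`, given by the coefficients of the `q`-binomial theorem. -/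
def qBinomSeries (Q t : K) (s : ℕ) : K⟦X⟧ :=
  PowerSeries.mk fun n => qPoch (Q ^ s) Q n / qPoch Q Q n * t ^ n

theorem qBinomSeries_zero (t : K) : qBinomSeries Q t 0 = 1 := by
  ext n
  rcases n with _ | n
  · simp [qBinomSeries, qPoch_zero]
  · simp [qBinomSeries, qPoch_succ', coeff_one]

theorem qBinomSeries_succ_mul (hQ : ∀ k : ℕ, 0 < k → Q ^ k ≠ 1) (t : K) (s : ℕ) :
    qBinomSeries Q t (s + 1) * (1 - C (t * Q ^ s) * X) = qBinomSeries Q t s := by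
  rw [show qBinomSeries Q t (s + 1) * (1 - C (t * Q ^ s) * X) = qBinomSeries Q t (s + 1) -
    C (t * Q ^ s) * (X * qBinomSeries Q t (s + 1)) by ring]
  ext n
  rw [map_sub, coeff_C_mul]
  rcases n with _ | n
  · simp [qBinomSeries, qPoch_zero]
  · rw [coeff_succ_X_mul]
    simp only [qBinomSeries, coeff_mk]
    have hn := qPoch_self_ne_zero hQ (n + 1)
    rw [qPoch_succ' (Q ^ s), qPoch_succ (Q ^ (s + 1)), ← pow_succ]
    rw [qPoch_succ, ← pow_succ'] at hn ⊢
    have := left_ne_zero_of_mul hn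
    have := right_ne_zero_of_mul hn
    field_simp
    ring

theorem qBinomSeries_mul_qPoch (hQ : ∀ k : ℕ, 0 < k → Q ^ k ≠ 1) (t : K) (s : ℕ) :
    qBinomSeries Q t s * qPoch (C t * X) (C Q) s = 1 := by
  induction s with
  | zero => rw [qBinomSeries_zero, qPoch_zero, one_mul]
  | succ s ih =>
    rw [← ih, ← qBinomSeries_succ_mul hQ t s, qPoch_succ, map_mul, map_pow]
    ring

/-- Removing the first, rather than the last, factor of the denominator `(t X; Q)_{s+1}`. -/
theorem one_sub_mul_qBinomSeries_succ (hQ : ∀ k : ℕ, 0 < k → Q ^ k ≠ 1) (t : K) (s : ℕ) :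
    (1 - C t * X) * qBinomSeries Q t (s + 1) = qBinomSeries Q (t * Q) s := by
  have h₁ := qBinomSeries_mul_qPoch hQ t (s + 1)
  have h₂ := qBinomSeries_mul_qPoch hQ (t * Q) s
  rw [qPoch_succ', show (C t * X * C Q : K⟦X⟧) = C (t * Q) * X by rw [map_mul]; ring] at h₁
  linear_combination qBinomSeries Q (t * Q) s * h₁ -
    (1 - C t * X) * qBinomSeries Q t (s + 1) * h₂

theorem rescale_qBinomSeries (r t : K) (s : ℕ) :
    rescale r (qBinomSeries Q t s) = qBinomSeries Q (r * t) s := by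
  ext n
  simp only [qBinomSeries, coeff_rescale, coeff_mk, mul_pow]
  ring

theorem rescale_C (r t : K) : rescale r (C t : K⟦X⟧) = C t := by
  ext n
  rcases n with _ | n <;> simp [coeff_rescale, coeff_C]

theorem rescale_qPoch_neg (r t : K) (s : ℕ) :
    rescale r (qPoch (-(C t * X)) (C Q) s : K⟦X⟧) = qPoch (-(C (r * t) * X)) (C Q) s := by
  rw [map_qPoch, map_neg, map_mul, rescale_C, rescale_C, rescale_X, map_mul]
  congr 2
  ring

theorem qPoch_pow_div_qPoch_self (hQ : ∀ k : ℕ, 0 < k → Q ^ k ≠ 1) (s n : ℕ) :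
    qPoch (Q ^ (s + 1)) Q n / qPoch Q Q n = gaussBinom Q (n + s) n := by
  have h := qPoch_self_ne_zero hQ
  rw [gaussBinom_add_left, add_comm n s, qPoch_add Q Q s n, ← pow_succ']
  have := h s
  have := h n
  field_simp

end Field

/-! ### Generating functions in the number of rows -/

section RowSeries

variable {K : Type*} [Field K] {Q : K}

theorem qPoch_neg_succ' (t : K) (n : ℕ) :
    (qPoch (-(C t * X)) (C Q) (n + 1) : K⟦X⟧) =
      (1 + C t * X) * qPoch (-(C (Q * t) * X)) (C Q) n := by
  rw [qPoch_succ', sub_neg_eq_add, show (-(C t * X) * C Q : K⟦X⟧) = -(C (Q * t) * X) by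
    rw [map_mul]; ring]

/-- The power series `(-abc X; Q)_i (-a X; Q)_j / ((X; Q)_{i+1} (ac X; Q)_j)`. For `i = l` and
`j = l + ν` its coefficient of `X ^ M` is the triple sum over `m₂`, `m₁`, `n` in the formula for
the bounded generating function. -/
noncomputable def rowSeries (Q a b c : K) (i j : ℕ) : K⟦X⟧ :=
  qPoch (-(C (a * b * c) * X)) (C Q) i * qPoch (-(C a * X)) (C Q) j *
    (qBinomSeries Q (a * c) j * qBinomSeries Q 1 (i + 1))

theorem one_sub_X_mul_rowSeries_succ_succ (hQ : ∀ k : ℕ, 0 < k → Q ^ k ≠ 1) {a b c d : K}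
    (h : Q = a * b * c * d) (i j : ℕ) :
    (1 - X) * rowSeries Q a b c (i + 1) (j + 1) =
      (1 + C (a * b * c) * X) * rescale Q (rowSeries Q a b c i j) +
        C (a * (1 + c)) * (X * rescale (a * c) (rowSeries Q b a d j (i + 1))) := by
  have e₁ := one_sub_mul_qBinomSeries_succ hQ 1 (i + 1)
  have e₂ := one_sub_mul_qBinomSeries_succ hQ (a * c) j
  simp only [rowSeries, map_mul (rescale _), rescale_qBinomSeries, rescale_qPoch_neg]
  rw [show a * c * (b * a * d) = Q * a by rw [h]; ring, show a * c * b = a * b * c by ring,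
    show a * c * (b * d) = 1 * Q by rw [h]; ring, show Q * (a * c) = a * c * Q by ring,
    mul_one (a * c), mul_comm Q 1, ← e₁, ← e₂, qPoch_neg_succ' (a * b * c), qPoch_neg_succ' a]
  simp only [map_mul, map_add, map_one]
  ring

theorem one_sub_X_mul_rowSeries_zero_zero (hQ : ∀ k : ℕ, 0 < k → Q ^ k ≠ 1) (a b c : K) :
    (1 - X) * rowSeries Q a b c 0 0 = 1 := by
  have e₁ := one_sub_mul_qBinomSeries_succ hQ 1 0
  simp only [rowSeries, qPoch_zero, qBinomSeries_zero, map_one, one_mul] at e₁ ⊢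
  exact e₁

theorem one_sub_X_mul_rowSeries_zero_one (hQ : ∀ k : ℕ, 0 < k → Q ^ k ≠ 1) (a b c d : K) :
    (1 - X) * rowSeries Q a b c 0 1 =
      1 + C (a * (1 + c)) * (X * rescale (a * c) (rowSeries Q b a d 0 0)) := by
  have e₁ := one_sub_mul_qBinomSeries_succ hQ 1 0
  have e₂ := one_sub_mul_qBinomSeries_succ hQ (a * c) 0
  simp only [rowSeries, rescale_qBinomSeries, qPoch_neg_succ', qPoch_zero,
    qBinomSeries_zero, map_one, one_mul, mul_one, zero_add] at e₁ e₂ ⊢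
  simp only [map_mul, map_add, map_one] at e₂ ⊢
  linear_combination (1 + C a * X) * qBinomSeries Q (a * c) 1 * e₁ + e₂

theorem coeff_succ_one_sub_X_mul (f : K⟦X⟧) (M : ℕ) :
    coeff (M + 1) ((1 - X) * f) = coeff (M + 1) f - coeff M f := by
  rw [sub_mul, one_mul, map_sub, coeff_succ_X_mul]

theorem coeff_rowSeries_succ_succ (hQ : ∀ k : ℕ, 0 < k → Q ^ k ≠ 1) {a b c d : K}
    (h : Q = a * b * c * d) (i j M : ℕ) :
    coeff (M + 1) (rowSeries Q a b c (i + 1) (j + 1)) -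
        Q ^ (M + 1) * coeff (M + 1) (rowSeries Q a b c i j) =
      coeff M (rowSeries Q a b c (i + 1) (j + 1)) +
        a * b * c * Q ^ M * coeff M (rowSeries Q a b c i j) +
        (a * c) ^ M * (a * (1 + c)) * coeff M (rowSeries Q b a d j (i + 1)) := by
  have key := congrArg (coeff (M + 1)) (one_sub_X_mul_rowSeries_succ_succ hQ h i j)
  rw [coeff_succ_one_sub_X_mul, add_mul, one_mul, mul_assoc (C _) X, map_add, map_add, coeff_C_mul,
    coeff_C_mul, coeff_succ_X_mul, coeff_succ_X_mul, coeff_rescale, coeff_rescale,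
    coeff_rescale] at key
  linear_combination key

/-- The generating function in the largest part `L` of the coefficients of `X ^ M` in the row
series attached to `L`, namely those with `i = ⌊L / 2⌋` and `j = ⌈L / 2⌉`. -/
noncomputable def rowCoeffSeries (Q a b c : K) (M : ℕ) : K⟦X⟧ :=
  PowerSeries.mk fun L => coeff M (rowSeries Q a b c (L / 2) ((L + 1) / 2))

theorem rowCoeffSeries_succ (hQ : ∀ k : ℕ, 0 < k → Q ^ k ≠ 1) {a b c d : K}
    (h : Q = a * b * c * d) (M : ℕ) :
    (1 - C (Q ^ (M + 1)) * X ^ 2) * rowCoeffSeries Q a b c (M + 1) =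
      (1 + C (a * b * c * Q ^ M) * X ^ 2) * rowCoeffSeries Q a b c M +
        C ((a * c) ^ M * (a * (1 + c))) * (X * rowCoeffSeries Q b a d M) := by
  rw [sub_mul, add_mul, one_mul, one_mul, mul_assoc, mul_assoc]
  ext L
  rw [map_sub, map_add, map_add, coeff_C_mul, coeff_C_mul, coeff_C_mul, coeff_X_pow_mul',
    coeff_X_pow_mul']
  rcases L with _ | _ | L
  -- The relations for `L = 0, 1` lack the term with index `L - 2`.
  · have key := congrArg (coeff (M + 1)) (one_sub_X_mul_rowSeries_zero_zero hQ a b c)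
    rw [coeff_succ_one_sub_X_mul, coeff_one, if_neg M.succ_ne_zero] at key
    simp only [rowCoeffSeries, coeff_mk, coeff_zero_X_mul]
    norm_num
    linear_combination key
  · have key := congrArg (coeff (M + 1)) (one_sub_X_mul_rowSeries_zero_one hQ a b c d)
    rw [coeff_succ_one_sub_X_mul, map_add, coeff_one, if_neg M.succ_ne_zero, coeff_C_mul,
      coeff_succ_X_mul, coeff_rescale] at key
    simp only [rowCoeffSeries, coeff_mk, coeff_succ_X_mul]
    norm_num
    linear_combination key
  · have key := coeff_rowSeries_succ_succ hQ h (L / 2) ((L + 1) / 2) M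
    simp only [rowCoeffSeries, coeff_mk, coeff_succ_X_mul]
    rw [if_pos (by omega), if_pos (by omega), show (L + 1 + 1) / 2 = L / 2 + 1 by omega,
      show (L + 1 + 1 + 1) / 2 = (L + 1) / 2 + 1 by omega, show L + 1 + 1 - 2 = L by omega]
    linear_combination key

theorem rowCoeffSeries_zero (a b c : K) : rowCoeffSeries Q a b c 0 = PowerSeries.mk fun _ => 1 := by
  ext L
  simp [rowCoeffSeries, rowSeries, qBinomSeries, qPoch]

end RowSeries

/-! ### Generating functions in the largest part -/

section PhiSeries

variable {K : Type*} [Field K] {Q : K}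

/-- The generating function `∑ L, Φ_{L,P}(a,b,c,d) X ^ L`. -/
noncomputable def phiSeries (a b c d : K) (P : ℕ) : K⟦X⟧ :=
  PowerSeries.mk fun L => boundedPhi L P a b c d

theorem phiSeries_zero (a b c d : K) : phiSeries a b c d 0 = PowerSeries.mk fun _ => 1 := by
  ext L
  simp [phiSeries, boundedPhi_eq_one]

theorem phiSeries_succ (a b c d : K) (P : ℕ) :
    phiSeries a b c d (P + 1) = phiSeries a b c d P +
      C (columnWeight a c (P + 1)) * (X * phiSeries b a d c (P + 1)) := by
  ext L
  rw [map_add, coeff_C_mul]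
  rcases L with _ | L
  · simp [phiSeries, boundedPhi_eq_one]
  · rw [coeff_succ_X_mul]
    simp only [phiSeries, coeff_mk, boundedPhi_succ_succ]

/-- Four uses of the column recursion, with the row bounds `2 * M + 1` and `2 * M + 2` and with the
weights `(a, b, c, d)` and `(b, a, d, c)`, eliminate the odd row bound. -/
theorem phiSeries_two_mul_succ {a b c d : K} (h : Q = a * b * c * d) (M : ℕ) :
    (1 - C (Q ^ (M + 1)) * X ^ 2) * ((1 - C (a * b) * X ^ 2 * C Q ^ M) *
        phiSeries a b c d (2 * (M + 1))) =
      (1 + C (a * b * c * Q ^ M) * X ^ 2) * phiSeries a b c d (2 * M) +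
        C ((a * c) ^ M * (a * (1 + c))) * (X * phiSeries b a d c (2 * M)) := by
  have h₁ := phiSeries_succ a b c d (2 * M)
  have h₂ := phiSeries_succ b a d c (2 * M)
  have h₃ := phiSeries_succ a b c d (2 * M + 1)
  have h₄ := phiSeries_succ b a d c (2 * M + 1)
  rw [show 2 * M + 1 + 1 = 2 * (M + 1) by ring, columnWeight_two_mul] at h₃ h₄
  rw [columnWeight_two_mul_add_one] at h₁ h₂
  subst h
  simp only [map_mul, map_pow, map_add, map_one] at *
  generalize phiSeries a b c d (2 * (M + 1)) = A at *
  generalize phiSeries b a d c (2 * (M + 1)) = A' at *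
  generalize phiSeries a b c d (2 * M + 1) = B at *
  generalize phiSeries b a d c (2 * M + 1) = B' at *
  generalize phiSeries a b c d (2 * M) = A₀ at *
  generalize phiSeries b a d c (2 * M) = A₀' at *
  generalize (C a : K⟦X⟧) = a at *
  generalize (C b : K⟦X⟧) = b at *
  generalize (C c : K⟦X⟧) = c at *
  generalize (C d : K⟦X⟧) = d at *
  -- Solving the two relations for the bound `2 * M + 1`, first for `B` and then for `B'`.
  have hB : (1 - a * b * (a * b * c * d) ^ M * X ^ 2) * B =
      A₀ + (a * c) ^ M * a * X * A₀' := by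
    linear_combination h₁ + (a * c) ^ M * a * X * h₂
  have hB' : (1 - a * b * (a * b * c * d) ^ M * X ^ 2) * B' =
      A₀' + (b * d) ^ M * b * X * A₀ := by
    linear_combination h₂ + (b * d) ^ M * b * X * h₁
  linear_combination (1 - a * b * (a * b * c * d) ^ M * X ^ 2) *
    (h₃ + (a * c) ^ (M + 1) * X * h₄) + hB + (a * c) ^ (M + 1) * X * hB'

/-- Both sides satisfy the same first-order recursion in `M`, which couples the weights
`(a, b, c, d)` and `(b, a, d, c)`; the induction therefore treats all weights at once. -/
theorem rowCoeffSeries_eq (hQ : ∀ k : ℕ, 0 < k → Q ^ k ≠ 1) {a b c d : K}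
    (h : Q = a * b * c * d) (M : ℕ) :
    rowCoeffSeries Q a b c M =
      phiSeries a b c d (2 * M) * qPoch (C (a * b) * X ^ 2) (C Q) M := by
  induction M generalizing a b c d with
  | zero => rw [rowCoeffSeries_zero, phiSeries_zero, qPoch_zero, mul_one]
  | succ M ih =>
    have hne : (1 - C (Q ^ (M + 1)) * X ^ 2 : K⟦X⟧) ≠ 0 := by
      intro h0
      simpa using congrArg (coeff 0) h0
    refine mul_left_cancel₀ hne ?_
    have h' : Q = b * a * d * c := by rw [h]; ring
    rw [rowCoeffSeries_succ hQ h, ih h, ih h', qPoch_succ, mul_comm b a]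
    linear_combination -qPoch (C (a * b) * X ^ 2) (C Q) M * phiSeries_two_mul_succ h M

theorem phiSeries_two_mul (hQ : ∀ k : ℕ, 0 < k → Q ^ k ≠ 1) {a b c d : K}
    (h : Q = a * b * c * d) (M : ℕ) :
    phiSeries a b c d (2 * M) =
      rowCoeffSeries Q a b c M * expand 2 two_ne_zero (qBinomSeries Q (a * b) M) := by
  have key := congrArg (expand 2 two_ne_zero) (qBinomSeries_mul_qPoch hQ (a * b) M)
  rw [map_mul, map_one, ← AlgHom.coe_toRingHom, map_qPoch, map_mul, AlgHom.coe_toRingHom,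
    expand_C, expand_C, expand_X] at key
  rw [rowCoeffSeries_eq hQ h]
  linear_combination -phiSeries a b c d (2 * M) * key

/-- Only the terms in which the second index is even contribute, since the second factor is a series
in `X ^ 2`. -/
theorem coeff_mul_expand_two (f g : K⟦X⟧) {ν : ℕ} (hν : ν < 2) (N : ℕ) :
    coeff (2 * N + ν) (f * expand 2 two_ne_zero g) =
      ∑ l ∈ Finset.range (N + 1), coeff (N - l) g * coeff (2 * l + ν) f := by
  rw [coeff_mul]
  symm
  refine Finset.sum_of_injOn (fun l => (2 * l + ν, 2 * (N - l))) ?_ ?_ ?_ ?_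
  · intro l _ l' _ hl
    have := (Prod.mk.inj hl).1
    omega
  · intro l hl
    simp only [Finset.coe_range, Set.mem_Iio, Finset.mem_coe,
      Finset.HasAntidiagonal.mem_antidiagonal] at hl ⊢
    omega
  · rintro ⟨i, j⟩ hij hnot
    rw [Finset.HasAntidiagonal.mem_antidiagonal] at hij
    simp only at hij
    rw [coeff_expand_of_not_dvd, mul_zero]
    rintro ⟨k, rfl⟩
    refine hnot ⟨N - k, ?_, ?_⟩
    · simp only [Finset.coe_range, Set.mem_Iio]
      omega
    · simp only [Prod.mk.injEq]
      omega
  · intro l _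
    rw [coeff_expand_mul, mul_comm]

end PhiSeries

/-! ### Reading off the coefficients -/

section Coefficients

variable {K : Type*} [Field K] {Q : K}

theorem qPoch_neg_eq_sum (hQ : ∀ k : ℕ, 0 < k → Q ^ k ≠ 1) (t : K) (n : ℕ) :
    (qPoch (-(C t * X)) (C Q) n : K⟦X⟧) =
      ∑ m ∈ Finset.range (n + 1), C (t ^ m * Q ^ m.choose 2 * gaussBinom Q n m) * X ^ m := by
  ext k
  simp only [coeff_qPoch_neg hQ, map_sum, coeff_C_mul_X_pow]
  rw [Finset.sum_ite_eq]
  split_ifs with hk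
  · rfl
  · rw [gaussBinom_eq_zero_of_lt (by simpa using hk), mul_zero]

theorem coeff_qBinomSeries_mul_qBinomSeries_one (hQ : ∀ k : ℕ, 0 < k → Q ^ k ≠ 1) (t : K)
    (s l k : ℕ) :
    coeff k (qBinomSeries Q t s * qBinomSeries Q 1 (l + 1)) =
      ∑ n ∈ Finset.range (k + 1), gaussBinom Q (k - n + l) (k - n) *
        (qPoch (Q ^ s) Q n / qPoch Q Q n) * t ^ n := by
  rw [coeff_mul, Finset.Nat.sum_antidiagonal_eq_sum_range_succ_mk]
  refine Finset.sum_congr rfl fun n _ => ?_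
  simp only [qBinomSeries, coeff_mk, one_pow, mul_one, qPoch_pow_div_qPoch_self hQ l]
  ring

theorem coeff_rowSeries (hQ : ∀ k : ℕ, 0 < k → Q ^ k ≠ 1) (a b c : K) (i j M : ℕ) :
    coeff M (rowSeries Q a b c i j) =
      ∑ m₂ ∈ Finset.range (i + 1),
        (a * b * c) ^ m₂ * Q ^ (m₂.choose 2) * gaussBinom Q i m₂ *
        ∑ m₁ ∈ Finset.range (j + 1),
          a ^ m₁ * Q ^ (m₁.choose 2) * gaussBinom Q j m₁ *
          ∑ n ∈ Finset.range (M + 1 - (m₁ + m₂)),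
            gaussBinom Q (M + i - n - m₁ - m₂) (M - n - m₁ - m₂) *
              (qPoch (Q ^ j) Q n / qPoch Q Q n) * (a * c) ^ n := by
  rw [rowSeries, qPoch_neg_eq_sum hQ, qPoch_neg_eq_sum hQ, Finset.sum_mul_sum, Finset.sum_mul,
    map_sum]
  refine Finset.sum_congr rfl fun m₂ _ => ?_
  rw [Finset.sum_mul, map_sum, Finset.mul_sum]
  refine Finset.sum_congr rfl fun m₁ _ => ?_
  generalize (a * b * c) ^ m₂ * Q ^ (m₂.choose 2) * gaussBinom Q i m₂ = u
  generalize a ^ m₁ * Q ^ (m₁.choose 2) * gaussBinom Q j m₁ = v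
  rw [show ∀ F : K⟦X⟧, C u * X ^ m₂ * (C v * X ^ m₁) * F = C (u * v) * (X ^ (m₁ + m₂) * F) from
    fun F => by rw [map_mul, pow_add]; ring, coeff_C_mul, coeff_X_pow_mul', mul_assoc]
  congr 2
  split_ifs with hle
  · rw [coeff_qBinomSeries_mul_qBinomSeries_one hQ, ← Nat.sub_add_comm hle]
    refine Finset.sum_congr rfl fun n hn => ?_
    rw [Finset.mem_range] at hn
    rw [show M - (m₁ + m₂) - n + i = M + i - n - m₁ - m₂ by omega,
      show M - (m₁ + m₂) - n = M - n - m₁ - m₂ by omega]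
  · rw [Nat.sub_eq_zero_of_le (by omega), Finset.sum_range_zero]

/-- With all four weights equal to `q`, the column recursion is the `q`-Pascal rule. -/
theorem boundedPhi_self {q : K} (hq : ∀ k : ℕ, 0 < k → q ^ k ≠ 1) (L P : ℕ) :
    boundedPhi L P q q q q = gaussBinom q (L + P) P := by
  induction P generalizing L with
  | zero => rw [boundedPhi_eq_one _ _ _ _ (Or.inr rfl), gaussBinom_zero_right hq]
  | succ P ihP =>
    induction L with
    | zero => rw [boundedPhi_eq_one _ _ _ _ (Or.inl rfl), zero_add, gaussBinom_self hq]
    | succ L ihL =>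
      rw [boundedPhi_succ_succ, ihP, ihL, show L + 1 + (P + 1) = P + (L + 1) + 1 by ring,
        gaussBinom_pascal_left hq, show L + 1 + P = P + (L + 1) by ring,
        show L + (P + 1) = P + (L + 1) by ring]
      simp [columnWeight]

end Coefficients

/-- The sum over `n` runs over `0 ≤ n ≤ M - m₁ - m₂`, and is empty if `M < m₁ + m₂`. -/
theorem mainTheorem9 {K : Type*} [Field K] :
    (∀ (a b c d Q : K), Q = a * b * c * d → (∀ k : ℕ, 0 < k → Q ^ k ≠ 1) →
      ∀ (N M ν : ℕ), (ν = 0 ∨ ν = 1) → 0 < 2 * N + ν → 0 < M →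
        boundedPhi (2 * N + ν) (2 * M) a b c d =
          ∑ l ∈ Finset.range (N + 1),
            gaussBinom Q (N - l + M - 1) (N - l) * (a * b) ^ (N - l) *
            ∑ m₂ ∈ Finset.range (l + 1),
              (a * b * c) ^ m₂ * Q ^ (m₂.choose 2) * gaussBinom Q l m₂ *
              ∑ m₁ ∈ Finset.range (l + ν + 1),
                a ^ m₁ * Q ^ (m₁.choose 2) * gaussBinom Q (l + ν) m₁ *
                ∑ n ∈ Finset.range (M + 1 - (m₁ + m₂)),
                  gaussBinom Q (M + l - n - m₁ - m₂) (M - n - m₁ - m₂) *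
                    (qPoch (Q ^ (l + ν)) Q n / qPoch Q Q n) * (a * c) ^ n) ∧
    (∀ q : K, (∀ k : ℕ, 0 < k → q ^ k ≠ 1) →
      ∀ L M : ℕ, boundedPhi L (2 * M) q q q q = gaussBinom q (L + 2 * M) (2 * M)) := by
  refine ⟨fun a b c d Q h hQ N M ν hν _ hM => ?_, fun q hq L M => boundedPhi_self hq L (2 * M)⟩
  obtain ⟨M, rfl⟩ := Nat.exists_eq_add_of_lt hM
  rw [zero_add]
  have key := congrArg (coeff (2 * N + ν)) (phiSeries_two_mul hQ h (M + 1))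
  rw [coeff_mul_expand_two _ _ (by omega), phiSeries, coeff_mk] at key
  rw [key]
  refine Finset.sum_congr rfl fun l _ => ?_
  rw [qBinomSeries, coeff_mk, qPoch_pow_div_qPoch_self hQ, rowCoeffSeries, coeff_mk,
    show (2 * l + ν) / 2 = l by omega, show (2 * l + ν + 1) / 2 = l + ν by omega,
    coeff_rowSeries hQ, show N - l + (M + 1) - 1 = N - l + M by omega]
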